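/- Let $R$ be one of the rings $\mathbb{Z},\mathbb{Q},\mathbb{R},\mathbb{C}$ (or, more generally, a commutative normed ring with $\|nx\| = n\|x\|$ for all $n\in\mathbb{N}$, $x\in R$). Let $M_2$ be the free monoid of words over the alphabet $\{a_1,a_2\}$, with empty word $\epsilon$. For $v\in M_2$ with $v \neq \epsilon$ let $\rho_v(w)$ be the number of (possibly overlapping) occurrences of $v$ as a subword of $w\in M_2$, and let $\rho_\epsilon(w)=|w|$. Let $\widehat{C}$ be the $R$-module of all finite $R$-linear combinations of the functions $\rho_v$ $(v \in M_2)$, modulo bounded functions; the class of $\rho_v$ is again denoted by $\rho_v$. Let $$B=\{\rho_w \mid w\in M_2 \text{ neither begins nor ends with } a_1\}$$ (including $w=\epsilon$), which is a basis of $\widehat{C}$, let $$B_U=\{\rho_\epsilon\}\cup\{\rho_{a_2}\}\cup\{\rho_{a_2a_1^ka_2} \mid k\ge 0\}\subset B,$$ let $U$ be the span of $B_U$, and let $V=U^\perp$ be the orthogonal complement of $U$ in $\widehat{C}$ with respect to the scalar product for which $B$ is orthonormal (so that $V$ is spanned by $B\setminus B_U$). For $k,m\ge 0$ and a non-empty word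 $v$ put $$\sigma_k^m(v)=\sum_{i=0}^{k-1}\sum_{j=0}^{m-1}\rho_{a_2a_1^iva_1^ja_2}\in\widehat{C}.$$ Then the set $$B_V'=\{\sigma_k^m(v) \mid k,m\ge 1,\ v\in M_2 \text{ a non-empty word that begins and ends with } a_2\}$$ is a basis of $V$. More precisely, the family of the classes $\sigma_k^m(v)$, indexed by all such triples $(k,m,v)$, is linearly independent over $R$, and its span is $V$. -/

import Mathlib

namespace CountingFunctions

/-- The words over the alphabet `{a₁, …, a_r}`, i.e. the elements of the free monoid `M_r`;
the empty word is `[]`. -/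
abbrev Word (r : ℕ) : Type := List (Fin r)

/-- The number of (possibly overlapping) occurrences of `v` in `w`: the number of starting positions
`j < |w|` such that `v` is a prefix of what is left of `w` after its first `j` letters.
For the empty word `v` this is `|w|`. -/
def occ {r : ℕ} (v w : Word r) : ℕ :=
  ((Finset.range w.length).filter (fun j => v <+: w.drop j)).card

section

variable (R : Type*) [NormedCommRing R]

/-- The elementary counting function `ρ_v`, with values in the coefficient ring `R`. -/
def rhoFun {r : ℕ} (v : Word r) : Word r → R := fun w => (occ v w : R)

/-- The module of counting functions: finite `R`-linear combinations of the `ρ_v`. -/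
def countingFunctions (r : ℕ) : Submodule R (Word r → R) :=
  Submodule.span R (Set.range (rhoFun R))

/-- The bounded functions on `M_r`. -/
def boundedFunctions (r : ℕ) : Submodule R (Word r → R) where
  carrier := {f | ∃ K : ℝ, ∀ w, ‖f w‖ ≤ K}
  zero_mem' := ⟨0, fun w => by simp⟩
  add_mem' := by
    rintro f g ⟨K, hK⟩ ⟨L, hL⟩
    exact ⟨K + L, fun w => (norm_add_le _ _).trans (add_le_add (hK w) (hL w))⟩
  smul_mem' := by
    rintro c f ⟨K, hK⟩
    exact ⟨‖c‖ * K, fun w =>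
      (norm_mul_le c (f w)).trans (mul_le_mul_of_nonneg_left (hK w) (norm_nonneg c))⟩

/-- The module `Ĉ` of counting functions on `M_r` modulo bounded (counting) functions. -/
abbrev CHat (r : ℕ) : Type _ :=
  countingFunctions R r ⧸ (boundedFunctions R r).submoduleOf (countingFunctions R r)

/-- The class of `ρ_v` in `Ĉ`. -/
def rho {r : ℕ} (v : Word r) : CHat R r :=
  Submodule.Quotient.mk ⟨rhoFun R v, Submodule.subset_span (Set.mem_range_self v)⟩

end

/-- The letter `a₁` of the two-letter alphabet. -/
abbrev a1 : Fin 2 := 0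

/-- The letter `a₂` of the two-letter alphabet. -/
abbrev a2 : Fin 2 := 1

section

variable (R : Type*) [NormedCommRing R]

/-- The set `B` of all classes `ρ_w` in `Ĉ(M₂)`, where `w` neither begins nor ends with `a₁`
(the empty word is allowed). -/
def B : Set (CHat R 2) :=
  {f | ∃ w : Word 2, w.head? ≠ some a1 ∧ w.getLast? ≠ some a1 ∧ f = rho R w}

/-- `B_U`, consisting of `ρ_ε`, `ρ_{a₂}` and all `ρ_{a₂ a₁^k a₂}`, `k ≥ 0`. -/
def BU : Set (CHat R 2) :=
  {rho R []} ∪ {rho R [a2]} ∪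
    {f | ∃ k : ℕ, f = rho R ([a2] ++ List.replicate k a1 ++ [a2])}

/-- The subspace `U` spanned by `B_U`. -/
def U : Submodule R (CHat R 2) := Submodule.span R (BU R)

/-- The element of `Ĉ(M₂)` with coordinates `x` with respect to `B`. -/
noncomputable def ofCoord : (B R →₀ R) →ₗ[R] CHat R 2 :=
  Finsupp.linearCombination R (fun b : B R => (b : CHat R 2))

/-- The coordinate vectors `x` (with respect to `B`) that are orthogonal, for the dot product
`∑ b, x b * y b`, to the coordinate vectors `y` of all elements of `U`. -/
def orthCoord : Submodule R (B R →₀ R) where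
  carrier := {x | ∀ y : B R →₀ R, ofCoord R y ∈ U R → x.sum (fun b c => c * y b) = 0}
  zero_mem' := fun y _ => by simp
  add_mem' := by
    intro x x' hx hx' y hy
    rw [Finsupp.sum_add_index' (fun b => by simp) (fun b c d => add_mul c d (y b)),
      hx y hy, hx' y hy, add_zero]
  smul_mem' := by
    intro c x hx y hy
    rw [Finsupp.sum_smul_index (fun b => by simp)]
    simp only [mul_assoc]
    rw [← Finsupp.mul_sum, hx y hy, mul_zero]

/-- The subspace `V = U^⊥` of `Ĉ(M₂)`: the orthogonal complement of `U` for the scalar product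
that makes `B` orthonormal. (As `U` is spanned by a subset of `B`, complex conjugation of the
coordinates `y` would make no difference when `R = ℂ`.) -/
noncomputable def V : Submodule R (CHat R 2) := (orthCoord R).map (ofCoord R)

/-- The rectangle sum `σ_k^m(v) = ∑_{i < k, j < m} ρ_{a₂ a₁^i v a₁^j a₂}`;
it is `0` when `k = 0` or `m = 0`. -/
def sigma (k m : ℕ) (v : Word 2) : CHat R 2 :=
  ∑ i ∈ Finset.range k, ∑ j ∈ Finset.range m,
    rho R ([a2] ++ List.replicate i a1 ++ v ++ List.replicate j a1 ++ [a2])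

end

/-- The parameters of the rectangle sums: `k, m ≥ 1` and a word `v` whose first and last letters
are `a₂`. -/
structure SumIndex where
  k : ℕ
  m : ℕ
  v : Word 2
  k_pos : 1 ≤ k
  m_pos : 1 ≤ m
  head_v : v.head? = some a2
  last_v : v.getLast? = some a2

/-- The set `B_V'` of all rectangle sums with `k, m ≥ 1`. -/
def BV' (R : Type*) [NormedCommRing R] : Set (CHat R 2) :=
  {f | ∃ t : SumIndex, f = sigma R t.k t.m t.v}

end CountingFunctions

/-! Independence of the classes `ρ_w`, for `w` neither beginning nor ending with `a₁`, is tested on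
the words `(u a₁^L)^n` with `L` large. No occurrence of such a nonempty `w` can use the padding, so
each of these counts is `n` times the count in `u`. A bounded combination therefore vanishes at
every `u`, and a word of minimal length in its support gives a contradiction
(`linearIndependent_rho`). By independence, `V` is spanned by `B \ B_U`, that is, by the classes of
the words `a₂ a₁^i v a₁^j a₂` with `v` beginning and ending with `a₂`. The `σ_k^m(v)` are their
partial sums in `i` and then in `j`. Taking partial sums is invertible (by backward differences), so
it preserves independence and span (`exists_sigma_family`). -/

namespace CountingFunctions

/-! ### Occurrences in words padded by `a₁`. -/

section Words

lemma occ_nil_left {r : ℕ} (w : Word r) : occ [] w = w.length := by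
  simp [occ]

lemma occ_nil_right {r : ℕ} (v : Word r) : occ v [] = 0 := by
  simp [occ]

lemma occ_cons {r : ℕ} (v : Word r) (a : Fin r) (w : Word r) :
    occ v (a :: w) = (if v <+: a :: w then 1 else 0) + occ v w := by
  simp only [occ, Finset.card_filter, List.length_cons]
  rw [Finset.sum_range_succ']
  simp [add_comm]

lemma occ_of_length_lt {r : ℕ} {v w : Word r} (h : w.length < v.length) : occ v w = 0 := by
  induction w with
  | nil => exact occ_nil_right v
  | cons a w ih =>
    rw [occ_cons, ih (by simp at h; omega), if_neg]
    intro hp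
    exact absurd hp.length_le (by omega)

lemma occ_self {r : ℕ} {v : Word r} (h : v ≠ []) : occ v v = 1 := by
  cases v with
  | nil => exact absurd rfl h
  | cons a v => rw [occ_cons, occ_of_length_lt (by simp), if_pos List.prefix_rfl]

lemma occ_of_length_eq {r : ℕ} {v w : Word r} (h : v.length = w.length) (hne : v ≠ w) :
    occ v w = 0 := by
  cases w with
  | nil => exact occ_nil_right v
  | cons a w =>
    rw [occ_cons, occ_of_length_lt (by simp [h]), if_neg]
    intro hp
    exact hne (hp.eq_of_length h)

/-- The words that neither begin nor end with `a₁`. -/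
def IsReduced (w : Word 2) : Prop := w.head? ≠ some a1 ∧ w.getLast? ≠ some a1

lemma occ_replicate_append {v : Word 2} (h0 : v ≠ []) (hv : IsReduced v) (L : ℕ) (x : Word 2) :
    occ v (List.replicate L a1 ++ x) = occ v x := by
  induction L with
  | zero => simp
  | succ L ih =>
    rw [List.replicate_succ, List.cons_append, occ_cons, ih, if_neg, zero_add]
    intro hp
    cases v with
    | nil => exact h0 rfl
    | cons b v =>
      rw [List.cons_prefix_cons] at hp
      exact hv.1 (by simp [hp.1])

/-- A prefix running past `u` would, since `|v| ≤ L`, stop inside the block of `a₁`, and so end with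
`a₁`. -/
lemma prefix_append_replicate_iff {v : Word 2} (hv : IsReduced v) {L : ℕ}
    (hL : v.length ≤ L) (u x : Word 2) :
    v <+: u ++ (List.replicate L a1 ++ x) ↔ v <+: u := by
  refine ⟨fun h => ?_, fun h => h.trans (List.prefix_append _ _)⟩
  rcases le_total v.length u.length with hle | hle
  · exact List.prefix_of_prefix_length_le h (List.prefix_append _ _) hle
  · obtain ⟨t, rfl⟩ := List.prefix_of_prefix_length_le (List.prefix_append _ _) h hle
    rw [List.prefix_append_right_inj] at h
    have ht : t <+: List.replicate L a1 :=
      List.prefix_of_prefix_length_le h (List.prefix_append _ _) (by simp at hL ⊢; omega)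
    rw [List.prefix_replicate_iff] at ht
    rcases Nat.eq_zero_or_pos t.length with h0 | h0
    · simp [List.length_eq_zero_iff.1 h0]
    · exfalso
      apply hv.2
      rw [ht.2, List.getLast?_append, List.getLast?_replicate, if_neg (by omega)]
      rfl

lemma occ_append_replicate_append {v : Word 2} (h0 : v ≠ []) (hv : IsReduced v) {L : ℕ}
    (hL : v.length ≤ L) (u x : Word 2) :
    occ v (u ++ (List.replicate L a1 ++ x)) = occ v u + occ v x := by
  induction u with
  | nil => simp [occ_replicate_append h0 hv, occ_nil_right]
  | cons a u ih =>
    have := prefix_append_replicate_iff hv hL (a :: u) x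
    rw [List.cons_append] at this
    rw [List.cons_append, occ_cons, occ_cons, ih, add_assoc]
    simp only [this]

/-- The `n`-th power of the word `u a₁^L`. -/
def paddedPow (u : Word 2) (L : ℕ) : ℕ → Word 2
  | 0 => []
  | n + 1 => u ++ (List.replicate L a1 ++ paddedPow u L n)

lemma occ_paddedPow {v : Word 2} (h0 : v ≠ []) (hv : IsReduced v) {L : ℕ}
    (hL : v.length ≤ L) (u : Word 2) (n : ℕ) : occ v (paddedPow u L n) = n * occ v u := by
  induction n with
  | zero => simp [paddedPow, occ_nil_right]
  | succ n ih => rw [paddedPow, occ_append_replicate_append h0 hv hL, ih]; ring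

lemma length_paddedPow (u : Word 2) (L n : ℕ) :
    (paddedPow u L n).length = n * (u.length + L) := by
  induction n with
  | zero => simp [paddedPow]
  | succ n ih => simp only [paddedPow, List.length_append, ih, List.length_replicate]; ring

/-! ### Normal forms of reduced words. -/

lemma eq_replicate_or_eq_replicate_append (u : Word 2) :
    (∃ k, u = List.replicate k a1) ∨ ∃ k t, u = List.replicate k a1 ++ a2 :: t := by
  induction u with
  | nil => exact Or.inl ⟨0, rfl⟩
  | cons a u ih =>
    obtain rfl | rfl : a = a1 ∨ a = a2 := by fin_cases a <;> simp
    · rcases ih with ⟨k, rfl⟩ | ⟨k, t, rfl⟩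
      · exact Or.inl ⟨k + 1, rfl⟩
      · exact Or.inr ⟨k + 1, t, rfl⟩
    · exact Or.inr ⟨0, u, rfl⟩

lemma eq_replicate_or_eq_append_replicate (u : Word 2) :
    (∃ k, u = List.replicate k a1) ∨ ∃ k t, u = t ++ a2 :: List.replicate k a1 := by
  rcases eq_replicate_or_eq_replicate_append u.reverse with ⟨k, h⟩ | ⟨k, t, h⟩
  · exact Or.inl ⟨k, by rw [← List.reverse_reverse u, h, List.reverse_replicate]⟩
  · exact Or.inr ⟨k, t.reverse, by rw [← List.reverse_reverse u, h]; simp⟩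

lemma replicate_append_cons_inj {i i' : ℕ} {t t' : Word 2}
    (h : List.replicate i a1 ++ a2 :: t = List.replicate i' a1 ++ a2 :: t') :
    i = i' ∧ t = t' := by
  induction i generalizing i' with
  | zero =>
    cases i' with
    | zero => simpa using h
    | succ i' => simp [List.replicate_succ] at h
  | succ i ih =>
    cases i' with
    | zero => simp [List.replicate_succ] at h
    | succ i' =>
      simp only [List.replicate_succ, List.cons_append, List.cons.injEq, true_and] at h
      obtain ⟨rfl, h'⟩ := ih h
      exact ⟨rfl, h'⟩

/-- The words that begin and end with `a₂`. -/
abbrev Core : Type := {v : Word 2 // v.head? = some a2 ∧ v.getLast? = some a2}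

/-- The word `a₂ a₁^i v a₁^j a₂`. -/
def frame (p : ℕ × ℕ × Core) : Word 2 :=
  [a2] ++ List.replicate p.1 a1 ++ p.2.2.1 ++ List.replicate p.2.1 a1 ++ [a2]

lemma Core.exists_cons (v : Core) : ∃ t, v.1 = a2 :: t := by
  obtain ⟨v, h, -⟩ := v
  cases v with
  | nil => simp at h
  | cons a t => simp at h; exact ⟨t, by simp [h]⟩

lemma Core.exists_concat (v : Core) : ∃ t, v.1 = t ++ [a2] :=
  List.getLast?_eq_some_iff.1 v.2.2

lemma isReduced_frame (p : ℕ × ℕ × Core) : IsReduced (frame p) := by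
  constructor
  · simp [frame]
  · rw [frame, List.getLast?_append]; simp

/-- As `v` begins and ends with `a₂`, the exponents are the lengths of the maximal `a₁`-runs next to
the outer letters. -/
lemma frame_injective : Function.Injective frame := by
  rintro ⟨i, j, v⟩ ⟨i', j', v'⟩ h
  simp only [frame, List.append_assoc, List.append_right_inj] at h
  simp only [← List.append_assoc, List.append_left_inj] at h
  obtain ⟨t, ht⟩ := v.exists_cons
  obtain ⟨t', ht'⟩ := v'.exists_cons
  have h1 := h
  rw [ht, ht', List.append_assoc, List.append_assoc, List.cons_append, List.cons_append] at h1
  obtain ⟨rfl, h2⟩ := replicate_append_cons_inj h1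
  have h3 : v.1 ++ List.replicate j a1 = v'.1 ++ List.replicate j' a1 := by
    rw [ht, ht', List.cons_append, List.cons_append, h2]
  obtain ⟨s, hs⟩ := v.exists_concat
  obtain ⟨s', hs'⟩ := v'.exists_concat
  have h4 := congrArg List.reverse h3
  rw [hs, hs'] at h4
  simp only [List.reverse_append, List.reverse_replicate, List.reverse_cons, List.reverse_nil,
    List.nil_append, List.cons_append] at h4
  obtain ⟨rfl, h5⟩ := replicate_append_cons_inj h4
  have : v = v' := Subtype.ext (List.append_cancel_right h3)
  rw [this]

/-- Separates framed words from those defining `B_U`, which contain at most two `a₂`. -/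
lemma count_frame (p : ℕ × ℕ × Core) : 3 ≤ (frame p).count a2 := by
  obtain ⟨t, ht⟩ := p.2.2.exists_cons
  simp [frame, ht, List.count_append, List.count_replicate]

/-- A word that neither begins nor ends with `a₁` is empty, `a₂`, of the form `a₂ a₁^k a₂`, or
of the form `a₂ a₁^i v a₁^j a₂` where `v` begins and ends with `a₂`. -/
lemma IsReduced.cases {w : Word 2} (hw : IsReduced w) :
    w = [] ∨ w = [a2] ∨ (∃ k, w = [a2] ++ List.replicate k a1 ++ [a2]) ∨ ∃ p, w = frame p := by
  obtain ⟨h1, h2⟩ := hw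
  cases w with
  | nil => exact Or.inl rfl
  | cons a w =>
    obtain rfl : a = a2 := by fin_cases a <;> simp_all
    right
    rcases List.eq_nil_or_concat w with rfl | ⟨u, b, rfl⟩
    · exact Or.inl rfl
    obtain rfl : b = a2 := by
      rw [List.concat_eq_append, ← List.cons_append, List.getLast?_append] at h2
      fin_cases b <;> simp_all
    right
    rcases eq_replicate_or_eq_replicate_append u with ⟨k, rfl⟩ | ⟨i, t, rfl⟩
    · exact Or.inl ⟨k, by simp⟩
    right
    rcases eq_replicate_or_eq_append_replicate (a2 :: t) with ⟨k, h⟩ | ⟨j, s, h⟩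
    · cases k <;> simp [List.replicate_succ] at h
    refine ⟨(i, j, ⟨s ++ [a2], ?_, by simp⟩), ?_⟩
    · cases s with
      | nil => rfl
      | cons c s =>
        simp only [List.cons_append, List.cons.injEq] at h
        simp [← h.1]
    · simp [frame, h]

lemma isReduced_nil : IsReduced [] := by simp [IsReduced]

lemma isReduced_singleton : IsReduced [a2] := by simp [IsReduced]

lemma isReduced_pair (k : ℕ) : IsReduced ([a2] ++ List.replicate k a1 ++ [a2]) := by
  constructor
  · simp
  · rw [List.getLast?_append]; simp

end Words

/-! ### Independence modulo bounded functions. -/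

section Independence

variable {R : Type*} [NormedCommRing R]

lemma eq_zero_of_forall_norm_nsmul_le (hR : ∀ (n : ℕ) (x : R), ‖n • x‖ = (n : ℝ) * ‖x‖)
    {x : R} {K : ℝ} (h : ∀ n : ℕ, ‖n • x‖ ≤ K) : x = 0 := by
  by_contra hx
  obtain ⟨n, hn⟩ := exists_nat_gt (K / ‖x‖)
  rw [div_lt_iff₀ (norm_pos_iff.2 hx), ← hR] at hn
  exact absurd (h n) (not_le.2 hn)

lemma rhoFun_paddedPow (v u : Word 2) (hv : IsReduced v) {L : ℕ} (hL : v.length ≤ L) (n : ℕ) :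
    rhoFun R v (paddedPow u L n)
      = n • ((if v = [] then u.length + L else occ v u : ℕ) : R) := by
  split_ifs with h
  · subst h
    rw [rhoFun, occ_nil_left, length_paddedPow, nsmul_eq_mul, Nat.cast_mul]
  · rw [rhoFun, occ_paddedPow h hv hL, nsmul_eq_mul, Nat.cast_mul]

/-- The classes `ρ_w` for words `w` that neither begin nor end with `a₁` are independent modulo
bounded functions. -/
theorem linearIndependent_rho (hR : ∀ (n : ℕ) (x : R), ‖n • x‖ = (n : ℝ) * ‖x‖) :
    LinearIndependent R (fun w : {w : Word 2 // IsReduced w} => rho R w.1) := by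
  rw [linearIndependent_iff]
  intro c hc
  have hbdd : ∃ K : ℝ, ∀ x, ‖c.sum (fun w r => r * rhoFun R w.1 x)‖ ≤ K := by
    have h1 : (Submodule.mkQ ((boundedFunctions R 2).submoduleOf (countingFunctions R 2)))
        (c.sum fun w r => r • (⟨rhoFun R w.1, Submodule.subset_span (Set.mem_range_self w.1)⟩ :
          countingFunctions R 2)) = 0 := by
      rw [← hc, Finsupp.linearCombination_apply, Finsupp.sum, Finsupp.sum, map_sum]
      rfl
    rw [← LinearMap.mem_ker, Submodule.ker_mkQ, Submodule.submoduleOf, Submodule.mem_comap] at h1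
    obtain ⟨K, hK⟩ := h1
    refine ⟨K, fun x => ?_⟩
    have h2 := hK x
    rw [Finsupp.sum, map_sum, Finset.sum_apply] at h2
    exact h2
  obtain ⟨K, hK⟩ := hbdd
  set N := c.support.sup (fun w => w.1.length) with hN
  have hlen : ∀ w ∈ c.support, w.1.length ≤ N := fun w hw =>
    Finset.le_sup (f := fun w : {w : Word 2 // IsReduced w} => w.1.length) hw
  have key : ∀ (u : Word 2) (L : ℕ), N ≤ L →
      c.sum (fun w r => r * ((if w.1 = [] then u.length + L else occ w.1 u : ℕ) : R)) = 0 := by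
    intro u L hL
    refine eq_zero_of_forall_norm_nsmul_le (K := K) hR fun n => ?_
    convert hK (paddedPow u L n) using 2
    rw [Finsupp.sum, Finsupp.sum, Finset.smul_sum]
    refine Finset.sum_congr rfl fun w hw => ?_
    rw [rhoFun_paddedPow w.1 u w.2 ((hlen w hw).trans hL), mul_smul_comm]
  by_contra hne
  have hsupp : c.support.Nonempty := Finsupp.support_nonempty_iff.2 hne
  obtain ⟨w₀, hw₀, hmin⟩ := c.support.exists_min_image (fun w => w.1.length) hsupp
  apply Finsupp.mem_support_iff.1 hw₀
  by_cases h0 : w₀.1 = []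
  -- With `u` empty only `ρ_ε` contributes; padding `N + 1` makes its factor nonzero even if `N =
  -- 0`.
  · have h := key [] (N + 1) (by omega)
    rw [Finsupp.sum, Finset.sum_eq_single_of_mem w₀ hw₀] at h
    · rw [if_pos h0, mul_comm, ← nsmul_eq_mul] at h
      have h2 := hR (([] : Word 2).length + (N + 1)) (c w₀)
      rw [h, norm_zero, eq_comm, mul_eq_zero] at h2
      rcases h2 with h2 | h2
      · rw [Nat.cast_eq_zero] at h2; omega
      · exact norm_eq_zero.1 h2
    · intro w _ hw
      rw [if_neg (fun h => hw (Subtype.ext (h.trans h0.symm))), occ_nil_right]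
      simp
  -- No other word of length at least `|w₀|` occurs in `w₀`.
  · have h := key w₀.1 N le_rfl
    rw [Finsupp.sum, Finset.sum_eq_single_of_mem w₀ hw₀] at h
    · simpa [h0, occ_self h0] using h
    · intro w hw hne'
      have hwle := hmin w hw
      have : w.1 ≠ [] := by
        intro hh
        rw [hh, List.length_nil, Nat.le_zero, List.length_eq_zero_iff] at hwle
        exact h0 hwle
      rw [if_neg this]
      rcases hwle.lt_or_eq with hlt | heq
      · rw [occ_of_length_lt hlt]; simp
      · rw [occ_of_length_eq heq.symm (fun hh => hne' (Subtype.ext hh))]; simp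

end Independence

/-! ### Partial sums as an invertible change of family. -/

section PartialSums

variable {R M ι : Type*} [CommRing R] [AddCommGroup M] [Module R M]

/-- The partial sums of a family in its first variable. -/
def partialSum (f : ℕ × ι → M) (p : ℕ × ι) : M := ∑ i ∈ Finset.range (p.1 + 1), f (i, p.2)

lemma partialSum_succ (f : ℕ × ι → M) (n : ℕ) (x : ι) :
    partialSum f (n + 1, x) = partialSum f (n, x) + f (n + 1, x) :=
  Finset.sum_range_succ _ _

lemma partialSum_zero (f : ℕ × ι → M) (x : ι) : partialSum f (0, x) = f (0, x) := by
  simp [partialSum]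

lemma span_range_partialSum (f : ℕ × ι → M) :
    Submodule.span R (Set.range (partialSum f)) = Submodule.span R (Set.range f) := by
  refine le_antisymm (Submodule.span_le.2 ?_) (Submodule.span_le.2 ?_)
  · rintro _ ⟨p, rfl⟩
    exact Submodule.sum_mem _ fun i _ => Submodule.subset_span ⟨_, rfl⟩
  · rintro _ ⟨⟨n, x⟩, rfl⟩
    cases n with
    | zero => exact Submodule.subset_span ⟨(0, x), partialSum_zero f x⟩
    | succ n =>
      rw [← add_sub_cancel_left (partialSum f (n, x)) (f (n + 1, x)), ← partialSum_succ]
      exact Submodule.sub_mem _ (Submodule.subset_span ⟨_, rfl⟩) (Submodule.subset_span ⟨_, rfl⟩)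

/-- The backward differences of the standard basis in the first variable. -/
noncomputable def singleDiff (R : Type*) [CommRing R] {ι : Type*} : ℕ × ι → (ℕ × ι →₀ R)
  | (0, x) => Finsupp.single (0, x) 1
  | (n + 1, x) => Finsupp.single (n + 1, x) 1 - Finsupp.single (n, x) 1

lemma partialSum_singleDiff (p : ℕ × ι) :
    partialSum (singleDiff R) p = Finsupp.single p 1 := by
  obtain ⟨n, x⟩ := p
  induction n with
  | zero => rw [partialSum_zero]; rfl
  | succ n ih => rw [partialSum_succ, ih, singleDiff, add_sub_cancel]

lemma linearIndependent_partialSum {f : ℕ × ι → M} (hf : LinearIndependent R f) :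
    LinearIndependent R (partialSum f) := by
  have hT : LinearIndependent R (partialSum fun p : ℕ × ι => Finsupp.single p (1 : R)) := by
    -- The difference operator carries the partial sums back to the standard basis.
    refine LinearIndependent.of_comp (Finsupp.linearCombination R (singleDiff R)) ?_
    convert Finsupp.linearIndependent_single_one R (ℕ × ι) using 1
    funext p
    simp only [Function.comp_apply, ← partialSum_singleDiff p, partialSum, map_sum,
      Finsupp.linearCombination_single, one_smul]
  have h := hT.map' (Finsupp.linearCombination R f) (LinearMap.ker_eq_bot.2 hf)
  have hcomp : partialSum f =
      Finsupp.linearCombination R f ∘ partialSum fun p : ℕ × ι => Finsupp.single p (1 : R) := by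
    funext p
    simp only [Function.comp_apply, partialSum, map_sum, Finsupp.linearCombination_single,
      one_smul]
  rwa [hcomp]

end PartialSums

/-! ### Rectangle sums and the orthogonal complement. -/

section Main

variable {R : Type*} [NormedCommRing R]

/-- The rectangle sums are independent and span the same submodule as the classes `ρ` of the
framed words, as they are iterated partial sums of these. -/
lemma exists_sigma_family (R : Type*) [NormedCommRing R]
    (hR : ∀ (n : ℕ) (x : R), ‖n • x‖ = (n : ℝ) * ‖x‖) :
    ∃ g : ℕ × ℕ × Core → CHat R 2,
      (∀ p, g p = sigma R (p.1 + 1) (p.2.1 + 1) p.2.2.1) ∧ LinearIndependent R g ∧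
      Submodule.span R (Set.range g) = Submodule.span R (Set.range fun p => rho R (frame p)) := by
  have hf : LinearIndependent R (fun p => rho R (frame p)) :=
    (linearIndependent_rho hR).comp (fun p => ⟨frame p, isReduced_frame p⟩)
      fun p q h => frame_injective (congrArg Subtype.val h)
  -- Swapping the exponents lets `partialSum` act on each in turn.
  let e : ℕ × ℕ × Core ≃ ℕ × ℕ × Core :=
    ⟨fun p => (p.2.1, p.1, p.2.2), fun p => (p.2.1, p.1, p.2.2), fun _ => rfl, fun _ => rfl⟩
  refine ⟨partialSum (partialSum ((fun p => rho R (frame p)) ∘ e) ∘ e), fun p => rfl, ?_, ?_⟩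
  · exact linearIndependent_partialSum
      ((linearIndependent_partialSum (hf.comp e e.injective)).comp e e.injective)
  · rw [span_range_partialSum, e.surjective.range_comp, span_range_partialSum,
      e.surjective.range_comp]

lemma B_eq_range : B R = Set.range (fun w : {w : Word 2 // IsReduced w} => rho R w.1) := by
  ext f
  constructor
  · rintro ⟨w, h1, h2, rfl⟩
    exact ⟨⟨w, h1, h2⟩, rfl⟩
  · rintro ⟨w, rfl⟩
    exact ⟨w.1, w.2.1, w.2.2, rfl⟩

lemma BU_subset_B : BU R ⊆ B R := by
  rw [B_eq_range]
  rintro f ((rfl | rfl) | ⟨k, rfl⟩)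
  · exact ⟨⟨_, isReduced_nil⟩, rfl⟩
  · exact ⟨⟨_, isReduced_singleton⟩, rfl⟩
  · exact ⟨⟨_, isReduced_pair k⟩, rfl⟩

lemma linearIndependent_B (hR : ∀ (n : ℕ) (x : R), ‖n • x‖ = (n : ℝ) * ‖x‖) :
    LinearIndependent R (fun b : B R => (b : CHat R 2)) := by
  rw [B_eq_range]
  exact (linearIndependent_rho hR).linearIndepOn_id

/-- The orthogonal complement of `U` is spanned by `B \ B_U`. -/
lemma V_eq_span_diff (hR : ∀ (n : ℕ) (x : R), ‖n • x‖ = (n : ℝ) * ‖x‖) :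
    V R = Submodule.span R (B R \ BU R) := by
  apply le_antisymm
  · rw [V, Submodule.map_le_iff_le_comap]
    intro x hx
    rw [Submodule.mem_comap, ofCoord, Finsupp.linearCombination_apply]
    refine Submodule.sum_mem _ fun b hb => Submodule.smul_mem _ _ (Submodule.subset_span ⟨b.2, ?_⟩)
    intro hbU
    have h := hx (Finsupp.single b 1)
      (by rw [ofCoord, Finsupp.linearCombination_single, one_smul]; exact Submodule.subset_span hbU)
    rw [Finsupp.sum, Finset.sum_eq_single_of_mem b hb] at h
    · rw [Finsupp.single_eq_same, mul_one] at h
      exact Finsupp.mem_support_iff.1 hb h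
    · intro b' _ hne
      rw [Finsupp.single_eq_of_ne hne, mul_zero]
  · rw [Submodule.span_le]
    rintro b ⟨hb, hbU⟩
    refine ⟨Finsupp.single ⟨b, hb⟩ 1, ?_, by simp [ofCoord]⟩
    intro y hy
    rw [Finsupp.sum_single_index (zero_mul _), one_mul]
    -- With uniqueness of coordinates, this makes `y` vanish off `B_U`.
    have hU : U R = (Finsupp.supported R R {b : B R | b.1 ∈ BU R}).map (ofCoord R) := by
      rw [ofCoord, ← Finsupp.span_image_eq_map_linearCombination, U]
      congr 1
      ext f
      exact ⟨fun h => ⟨⟨f, BU_subset_B h⟩, h, rfl⟩, by rintro ⟨b, h, rfl⟩; exact h⟩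
    rw [hU] at hy
    obtain ⟨z, hz, hzy⟩ := hy
    obtain rfl : z = y := linearIndependent_B hR hzy
    by_contra hne
    exact hbU (hz (Finsupp.mem_support_iff.2 hne))

/-- Over the zero ring all classes coincide: the left side is empty, the right side is not. -/
lemma B_diff_BU [Nontrivial R] (hR : ∀ (n : ℕ) (x : R), ‖n • x‖ = (n : ℝ) * ‖x‖) :
    B R \ BU R = Set.range fun p => rho R (frame p) := by
  have hinj := (linearIndependent_rho hR).injective
  ext f
  constructor
  · rintro ⟨⟨w, h1, h2, rfl⟩, hU⟩
    rcases IsReduced.cases ⟨h1, h2⟩ with rfl | rfl | ⟨k, rfl⟩ | ⟨p, rfl⟩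
    · exact absurd (Or.inl (Or.inl rfl)) hU
    · exact absurd (Or.inl (Or.inr rfl)) hU
    · exact absurd (Or.inr ⟨k, rfl⟩) hU
    · exact ⟨p, rfl⟩
  · rintro ⟨p, rfl⟩
    have hp := count_frame p
    have ne : ∀ w : Word 2, IsReduced w → w.count a2 < 3 → rho R (frame p) ≠ rho R w := by
      intro w hw hc h
      have := congrArg Subtype.val (@hinj ⟨_, isReduced_frame p⟩ ⟨w, hw⟩ h)
      simp only at this
      rw [this] at hp
      omega
    refine ⟨⟨_, (isReduced_frame p).1, (isReduced_frame p).2, rfl⟩, ?_⟩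
    rintro ((h | h) | ⟨k, h⟩)
    · exact ne _ isReduced_nil (by simp) h
    · exact ne _ isReduced_singleton (by simp) h
    · exact ne _ (isReduced_pair k)
        (by simp [List.count_append, List.count_replicate]) h

/-- A rectangle-sum index, with `k` and `m` shifted to start at zero. -/
def SumIndex.toTriple (t : SumIndex) : ℕ × ℕ × Core :=
  (t.k - 1, t.m - 1, ⟨t.v, t.head_v, t.last_v⟩)

lemma SumIndex.toTriple_injective : Function.Injective SumIndex.toTriple := by
  rintro ⟨k, m, v, hk, hm, _, _⟩ ⟨k', m', v', hk', hm', _, _⟩ h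
  simp only [SumIndex.toTriple, Prod.mk.injEq, Subtype.mk.injEq] at h
  obtain ⟨h1, h2, rfl⟩ := h
  obtain rfl : k = k' := by omega
  obtain rfl : m = m' := by omega
  rfl

end Main

end CountingFunctions

open CountingFunctions in
theorem proposition2p6 (R : Type*) [NormedCommRing R]
    (hR : ∀ (n : ℕ) (x : R), ‖n • x‖ = (n : ℝ) * ‖x‖) :
    LinearIndependent R
        (fun t : CountingFunctions.SumIndex => CountingFunctions.sigma R t.k t.m t.v) ∧
      Submodule.span R (CountingFunctions.BV' R) = CountingFunctions.V R := by
  obtain ⟨g, hg, hli, hspan⟩ := exists_sigma_family R hR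
  have hgt : ∀ t : SumIndex, g t.toTriple = sigma R t.k t.m t.v := by
    intro t
    rw [hg, SumIndex.toTriple, Nat.sub_add_cancel t.k_pos, Nat.sub_add_cancel t.m_pos]
  refine ⟨?_, ?_⟩
  · convert hli.comp _ SumIndex.toTriple_injective using 1
    exact funext fun t => (hgt t).symm
  · rcases subsingleton_or_nontrivial R with _ | _
    · have := Module.subsingleton R (CHat R 2)
      exact Subsingleton.elim _ _
    · rw [V_eq_span_diff hR, B_diff_BU hR, ← hspan]
      congr 1
      ext f
      constructor
      · rintro ⟨t, rfl⟩
        exact ⟨_, hgt t⟩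
      · rintro ⟨p, rfl⟩
        exact ⟨⟨p.1 + 1, p.2.1 + 1, p.2.2.1, by omega, by omega, p.2.2.2.1, p.2.2.2.2⟩, hg p⟩
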